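/- Let $\mathbb F_q$ be a finite field with $q$ elements, and let $t, k$ be non-negative integers with $t \le k < q$. Call a set $\mathcal F$ of polynomials in $\mathbb F_q[X]$ $t$-intersecting if for any two distinct $f, g \in \mathcal F$ there are at least $t$ elements $x \in \mathbb F_q$ with $f(x) = g(x)$. Let $\mathcal F$ be a $t$-intersecting set of polynomials in $\mathbb F_q[X]$, each of degree at most $k$ (the zero polynomial is allowed). Then $|\mathcal F| \le q^{k+1-t}$. Furthermore, if $t = 1$ and $k \ge 2$, then equality holds if and only if there are elements $x, y \in \mathbb F_q$ such that $$\mathcal F = \{ f \in \mathbb F_q[X] : \deg f \le k,\ f(x) = y \}.$$ -/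

import Mathlib

/-- Two polynomials over `F` are `t`-intersecting if they take the same value at at least `t`
elements of `F`. -/
def PolyTIntersecting {F : Type*} [Field F] (t : ℕ) (f g : Polynomial F) : Prop :=
  t ≤ {x : F | f.eval x = g.eval x}.ncard

/-- A family of polynomials is `t`-intersecting if any two distinct members are
`t`-intersecting. (A polynomial over a finite field `F` agrees with itself at all `|F|` elements,
so for `t ≤ |F|` requiring this also of equal members changes nothing.) -/
def IsTIntersectingFamily {F : Type*} [Field F] (t : ℕ) (𝓕 : Set (Polynomial F)) : Prop :=
  ∀ f ∈ 𝓕, ∀ g ∈ 𝓕, f ≠ g → PolyTIntersecting t f g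

/-! Bound: if `f + g = f' + g'` with `f`, `f'` in the family and `g`, `g'` of degree below `t`, then
`f - f'` has degree below `t`; were `f ≠ f'`, it would have at least `t` roots. So these sums are
distinct (`card_mul_card_degreeLT_le`).

Equality for `t = 1`: write q for the field size, V for the polynomials of degree at most `k`, S for
the family and s = |S| = |V|/q. If `h` has no root, the translates of S by multiples of `h` tile V,
so every nonzero functional killing `h` is equidistributed on S. A functional killing no rootless
polynomial is a multiple of an evaluation (`exists_eq_smul_evalDegreeLT`). Fourier inversion over
the dual then writes the indicator of S as a constant plus a sum of functions of single values f(x)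
(`sum_sliceExcess_eval`). Averaging this over fibres of evaluation pairs, and then over one slice of
size N, shows that N(s - N) is the same for all slices at a given point. With q ≥ 3, the slices at
that point are all equal or one is all of S; equality at every point would contradict the indicator
formula. -/

open Finset Module in
theorem card_fiber_mul_card {K V W : Type*} [Field K] [AddCommGroup V] [Module K V] [Fintype V]
    [AddCommGroup W] [Module K W] [Fintype W] [DecidableEq W] (φ : V →ₗ[K] W)
    (hφ : Function.Surjective φ) (w : W) :
    #{f : V | φ f = w} * Fintype.card W = Fintype.card V := by
  have h : ∀ u : W, #{f : V | φ f = u} = #{f : V | φ f = w} := fun u =>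
    AddMonoidHom.card_fiber_eq_of_mem_range φ.toAddMonoidHom (hφ u) (hφ w)
  rw [← Finset.card_univ (α := V),
    Finset.card_eq_sum_card_fiberwise (s := univ) (f := φ) (t := univ)
      (fun _ _ => Finset.mem_univ _),
    Finset.sum_congr rfl (fun u _ => h u), Finset.sum_const, smul_eq_mul, mul_comm,
    Finset.card_univ]

/-- Two distinct values with equal N(s - N) must add up to s. They exhaust the sum, so a third index
carries 0; the constant is then 0, and each value is 0 or s. -/
theorem exists_eq_of_mul_sub_const {ι : Type*} [Fintype ι] (hι : 3 ≤ Fintype.card ι) (s : ℚ)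
    (N : ι → ℚ) (hN : ∀ i, 0 ≤ N i) (hsum : ∑ i, N i = s)
    (hconst : ∀ i j, N i * (s - N i) = N j * (s - N j)) :
    (∀ i, Fintype.card ι * N i = s) ∨ ∃ i, N i = s := by
  classical
  by_cases h : ∀ i j, N i = N j
  · left
    intro i
    rw [← hsum, Finset.sum_congr rfl (fun j _ => h j i)]
    simp
  right
  push Not at h
  obtain ⟨i, j, hij⟩ := h
  have hne : i ≠ j := fun h => hij (h ▸ rfl)
  have hs : N i + N j = s := by
    have h1 : (N i - N j) * (s - (N i + N j)) = 0 := by linear_combination hconst i j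
    rcases mul_eq_zero.mp h1 with h2 | h2
    · exact absurd (sub_eq_zero.mp h2) hij
    · linarith
  obtain ⟨l, hl⟩ : ∃ l, l ∉ ({i, j} : Finset ι) := by
    by_contra! hall
    have := Finset.card_le_card (fun x _ => hall x : (Finset.univ : Finset ι) ⊆ {i, j})
    rw [Finset.card_univ] at this
    have := Finset.card_le_two (a := i) (b := j)
    omega
  simp only [Finset.mem_insert, Finset.mem_singleton, not_or] at hl
  have hle : N l + (N i + N j) ≤ s := by
    rw [← hsum]
    have := Finset.sum_le_sum_of_subset_of_nonneg (f := N) (Finset.subset_univ {l, i, j})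
      (fun x _ _ => hN x)
    rwa [Finset.sum_insert (by simp [hl.1, hl.2]), Finset.sum_pair hne] at this
  have hl0 : N l = 0 := le_antisymm (by linarith) (hN l)
  have h0 := hconst i l
  rw [hl0, zero_mul] at h0
  rcases mul_eq_zero.mp h0 with h1 | h1
  · exact ⟨j, by linarith⟩
  · exact ⟨i, by linarith⟩

/-! ### Slices by functionals and Fourier inversion -/

section Slices

open Finset Module

variable {K V : Type*} [Field K] [Fintype K] [DecidableEq K] [AddCommGroup V] [Module K V]

/-- The number of members of `S` at which the functional `ℓ` takes the value `c`. -/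
def sliceCard (S : Finset V) (ℓ : Dual K V) (c : K) : ℚ := #{g ∈ S | ℓ g = c}

/-- The normalised deviation of a slice of `S` from its average size. -/
def sliceExcess (S : Finset V) (ℓ : Dual K V) (c : K) : ℚ :=
  Fintype.card K * sliceCard S ℓ c - #S

theorem sum_sliceCard (S : Finset V) (ℓ : Dual K V) : ∑ c, sliceCard S ℓ c = #S := by
  unfold sliceCard
  rw [Finset.card_eq_sum_card_fiberwise (f := ℓ) (t := univ) (fun _ _ => Finset.mem_univ _)]
  push_cast
  rfl

theorem sum_sliceExcess (S : Finset V) (ℓ : Dual K V) : ∑ c, sliceExcess S ℓ c = 0 := by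
  simp [sliceExcess, Finset.sum_sub_distrib, ← Finset.mul_sum, sum_sliceCard]

theorem sliceExcess_smul (S : Finset V) (ℓ : Dual K V) {a : K} (ha : a ≠ 0) (f : V) :
    sliceExcess S (a • ℓ) ((a • ℓ) f) = sliceExcess S ℓ (ℓ f) := by
  simp [sliceExcess, sliceCard, ha]

variable [Fintype V]

/-- Two members of S agree under some `e x`, which is nonzero at `h`, so their difference is not a
nonzero multiple of `h`. By cardinality S + Kh tiles V. Translation along `h` preserves `ℓ`, so each
fibre of `ℓ` is tiled by a slice of S. -/
theorem sliceExcess_eq_zero {e : K → Dual K V} {S : Finset V}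
    (hcard : #S * Fintype.card K = Fintype.card V)
    (hS : ∀ f ∈ S, ∀ g ∈ S, ∃ x, e x f = e x g) {h : V} (hh : ∀ x, e x h ≠ 0)
    {ℓ : Dual K V} (hℓ : ℓ ≠ 0) (hℓh : ℓ h = 0) (c : K) : sliceExcess S ℓ c = 0 := by
  classical
  let Φ : V × K → V := fun p => p.1 + p.2 • h
  have hinj : Set.InjOn Φ (S ×ˢ (univ : Finset K) : Finset (V × K)) := by
    rintro ⟨f, a⟩ hf ⟨g, b⟩ hg hfg
    simp only [coe_product, coe_univ, Set.mem_prod, Set.mem_univ, and_true, mem_coe] at hf hg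
    obtain ⟨x, hx⟩ := hS f hf g hg
    have h1 := congrArg (e x) hfg
    simp only [Φ, map_add, map_smul, hx, smul_eq_mul, add_right_inj] at h1
    have hab : a = b := mul_right_cancel₀ (hh x) h1
    subst hab
    have : f = g := add_right_cancel hfg
    rw [this]
  have himg : (S ×ˢ (univ : Finset K)).image Φ = univ := by
    apply Finset.eq_univ_of_card
    rw [Finset.card_image_of_injOn hinj, Finset.card_product, Finset.card_univ, hcard]
  have hfib : ({f ∈ S | ℓ f = c} ×ˢ (univ : Finset K)).image Φ =
      ({f : V | ℓ f = c} : Finset V) := by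
    ext v
    simp only [mem_image, mem_product, mem_filter, mem_univ, and_true, true_and]
    constructor
    · rintro ⟨p, hp, rfl⟩
      simp [Φ, hℓh, hp.2]
    · intro hv
      have : v ∈ (S ×ˢ (univ : Finset K)).image Φ := himg ▸ mem_univ v
      obtain ⟨p, hp, rfl⟩ := mem_image.mp this
      refine ⟨p, ⟨(mem_product.mp hp).1, ?_⟩, rfl⟩
      simpa [Φ, hℓh] using hv
  have h1 := card_fiber_mul_card ℓ (LinearMap.surjective hℓ) c
  rw [← hfib, Finset.card_image_of_injOn (hinj.mono (by
    simp only [coe_product]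
    exact Set.prod_mono (coe_subset.mpr (filter_subset _ _)) subset_rfl)),
    Finset.card_product, Finset.card_univ, ← hcard] at h1
  have h2 := Nat.eq_of_mul_eq_mul_right Fintype.card_pos h1
  rw [sliceExcess, sliceCard, ← h2]
  push_cast
  ring

variable [Fintype (Dual K V)]

/-- Fourier inversion without characters: a nonzero vector is killed by exactly one functional in q,
the zero vector by all of them, so only the term g = f survives the normalisation. -/
theorem sum_dual_sliceExcess [DecidableEq V] {S : Finset V}
    (hcard : #S * Fintype.card K = Fintype.card V) (f : V) :
    ∑ ℓ : Dual K V, sliceExcess S ℓ (ℓ f) =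
      #S * Fintype.card K * (Fintype.card K - 1) * if f ∈ S then 1 else 0 := by
  have hdual : Fintype.card (Dual K V) = #S * Fintype.card K := by
    rw [hcard, Module.card_eq_pow_finrank (K := K), Subspace.dual_finrank_eq,
      ← Module.card_eq_pow_finrank]
  have hann : ∀ v : V, v ≠ 0 → #{ℓ : Dual K V | ℓ v = 0} = #S := by
    intro v hv
    have hne : Dual.eval K V v ≠ 0 := by
      intro h0
      exact hv ((Module.forall_dual_apply_eq_zero_iff K v).mp fun ℓ => LinearMap.congr_fun h0 ℓ)
    have := card_fiber_mul_card (Dual.eval K V v) (LinearMap.surjective hne) 0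
    rw [hdual] at this
    exact Nat.eq_of_mul_eq_mul_right Fintype.card_pos this
  have hcount : ∑ ℓ : Dual K V, sliceCard S ℓ (ℓ f) =
      ∑ g ∈ S, ((#S : ℚ) + if g = f then (#S * Fintype.card K - #S : ℚ) else 0) := by
    have h1 : ∀ ℓ : Dual K V, sliceCard S ℓ (ℓ f) = ∑ g ∈ S, if ℓ (g - f) = 0 then (1 : ℚ) else 0 := by
      intro ℓ
      simp [sliceCard, sub_eq_zero]
    simp_rw [h1]
    rw [Finset.sum_comm]
    refine Finset.sum_congr rfl fun g _ => ?_
    by_cases hg : g = f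
    · simp [hg, hdual]
    · rw [if_neg hg, add_zero, ← hann (g - f) (sub_ne_zero.mpr hg)]
      simp
  simp only [sliceExcess]
  rw [Finset.sum_sub_distrib, ← Finset.mul_sum, hcount, Finset.sum_add_distrib,
    Finset.sum_ite_eq' S f]
  simp only [sum_const, nsmul_eq_mul, Finset.card_univ, hdual]
  push_cast
  split_ifs <;> ring

theorem sum_sliceExcess_eval [DecidableEq V] {e : K → Dual K V} {S : Finset V}
    (hcard : #S * Fintype.card K = Fintype.card V)
    (hS : ∀ f ∈ S, ∀ g ∈ S, ∃ x, e x f = e x g)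
    (hpair : ∀ x y, x ≠ y → ∀ v w, ∃ f, e x f = v ∧ e y f = w)
    (hdual : ∀ ℓ : Dual K V, (∀ h, (∀ x, e x h ≠ 0) → ℓ h ≠ 0) → ∃ (x : K) (a : K), ℓ = a • e x) (f : V) :
    ∑ x, sliceExcess S (e x) (e x f) =
      #S * Fintype.card K * (if f ∈ S then 1 else 0) - #S := by
  classical
  have hone : ∀ x, ∃ f, e x f = 1 := by
    intro x
    obtain ⟨y, hy⟩ := exists_ne x
    obtain ⟨f, hf, -⟩ := hpair x y hy.symm 1 1
    exact ⟨f, hf⟩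
  have hq : (1 : ℚ) < Fintype.card K := by exact_mod_cast Fintype.one_lt_card
  let ψ : K × Kˣ → Dual K V := fun p => (p.2 : K) • e p.1
  have hψ : Function.Injective ψ := by
    rintro ⟨x, a⟩ ⟨y, b⟩ hab
    have hxy : x = y := by
      by_contra hne
      obtain ⟨g, hgx, hgy⟩ := hpair x y hne 1 0
      have := LinearMap.congr_fun hab g
      simp [ψ, hgx, hgy] at this
    subst hxy
    obtain ⟨g, hg⟩ := hone x
    have := LinearMap.congr_fun hab g
    simp only [ψ, LinearMap.smul_apply, hg, smul_eq_mul, mul_one] at this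
    rw [Units.ext this]
  have hψ0 : ∀ p, ψ p ≠ 0 := by
    rintro ⟨x, a⟩ h0
    obtain ⟨g, hg⟩ := hone x
    have := LinearMap.congr_fun h0 g
    simp [ψ, hg] at this
  -- Only zero and the nonzero multiples of evaluations contribute. The zero functional has excess
  -- (q - 1)s, which becomes the constant term.
  have hsplit : ∑ ℓ : Dual K V, sliceExcess S ℓ (ℓ f) =
      sliceExcess S (0 : Dual K V) 0 + ∑ p, sliceExcess S (ψ p) (ψ p f) := by
    rw [← Finset.sum_image (s := univ) (g := ψ) (f := fun ℓ => sliceExcess S ℓ (ℓ f))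
      (fun a _ b _ h => hψ h)]
    have h0 : (0 : Dual K V) ∉ univ.image ψ := by
      simp only [mem_image, mem_univ, true_and, not_exists]
      exact hψ0
    have : sliceExcess S (0 : Dual K V) 0 = sliceExcess S (0 : Dual K V) ((0 : Dual K V) f) := rfl
    rw [this, ← Finset.sum_insert (f := fun ℓ : Dual K V => sliceExcess S ℓ (ℓ f)) h0]
    symm
    apply Finset.sum_subset (Finset.subset_univ _)
    intro ℓ _ hℓ
    simp only [mem_insert, mem_image, mem_univ, true_and, not_or, not_exists] at hℓ
    by_cases hker : ∀ h, (∀ x, e x h ≠ 0) → ℓ h ≠ 0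
    · obtain ⟨x, a, rfl⟩ := hdual ℓ hker
      have ha : a ≠ 0 := by
        rintro rfl
        exact hℓ.1 (zero_smul _ _)
      exact absurd rfl (hℓ.2 (x, Units.mk0 a ha))
    · push Not at hker
      obtain ⟨h, hh, hℓh⟩ := hker
      exact sliceExcess_eq_zero hcard hS hh hℓ.1 hℓh _
  have hψsum : ∑ p, sliceExcess S (ψ p) (ψ p f) =
      (Fintype.card K - 1) * ∑ x, sliceExcess S (e x) (e x f) := by
    rw [Fintype.sum_prod_type, Finset.mul_sum]
    refine Finset.sum_congr rfl fun x _ => ?_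
    rw [Finset.sum_congr rfl fun a _ => sliceExcess_smul S (e x) (Units.ne_zero a) f]
    rw [Finset.sum_const, Finset.card_univ, Fintype.card_units, nsmul_eq_mul,
      Nat.cast_sub Fintype.card_pos, Nat.cast_one]
  rw [sum_dual_sliceExcess hcard, hψsum] at hsplit
  have hzero : sliceExcess S (0 : Dual K V) 0 = (Fintype.card K - 1) * #S := by
    simp [sliceExcess, sliceCard]
    ring
  rw [hzero] at hsplit
  have hne : (Fintype.card K - 1 : ℚ) ≠ 0 := by linarith
  apply mul_left_cancel₀ hne
  linear_combination -hsplit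

end Slices

/-! ### Values at two points and the size of a slice -/

section PointPairs

open Finset Module

variable {K V : Type*} [Field K] [Fintype K] [DecidableEq K] [AddCommGroup V] [Module K V]

/-- Sum `hsum` over the slice at `x`, `v`. By `hslice`, a point z ≠ x contributes its squared
excesses, the cross terms vanishing because excesses sum to zero. The point of the formula is that
its right side does not involve `v`. -/
theorem card_cube_mul_sliceCard_mul [DecidableEq V] {e : K → Dual K V} {S : Finset V}
    (hsum : ∀ f, ∑ x, sliceExcess S (e x) (e x f) =
      #S * Fintype.card K * (if f ∈ S then 1 else 0) - #S)
    (hslice : ∀ x z, x ≠ z → ∀ v w, (Fintype.card K : ℚ) ^ 2 * #{f ∈ S | e x f = v ∧ e z f = w} =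
      sliceExcess S (e x) v + sliceExcess S (e z) w + #S) (x v : K) :
    (Fintype.card K : ℚ) ^ 3 * (sliceCard S (e x) v * (#S - sliceCard S (e x) v)) =
      ∑ z ∈ univ.erase x, ∑ w, sliceExcess S (e z) w ^ 2 := by
  set T : Finset V := {f ∈ S | e x f = v} with hT
  have hTcard : (#T : ℚ) = sliceCard S (e x) v := rfl
  have h1 : ∑ f ∈ T, ∑ z, sliceExcess S (e z) (e z f) =
      #T * (#S * Fintype.card K - #S) := by
    rw [← nsmul_eq_mul, ← Finset.sum_const]
    refine Finset.sum_congr rfl fun f hf => ?_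
    rw [hsum, if_pos (mem_filter.mp hf).1, mul_one]
  have h2 : ∀ z, z ≠ x → (Fintype.card K : ℚ) ^ 2 * ∑ f ∈ T, sliceExcess S (e z) (e z f) =
      ∑ w, sliceExcess S (e z) w ^ 2 := by
    intro z hz
    rw [← Finset.sum_fiberwise_of_maps_to (g := e z) (t := univ) (fun _ _ => mem_univ _)]
    have hin : ∀ w, ∑ f ∈ T with e z f = w, sliceExcess S (e z) (e z f) =
        #{f ∈ S | e x f = v ∧ e z f = w} * sliceExcess S (e z) w := by
      intro w
      rw [hT, Finset.filter_filter, ← nsmul_eq_mul, ← Finset.sum_const]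
      refine Finset.sum_congr rfl fun f hf => ?_
      rw [(mem_filter.mp hf).2.2]
    have hin' : ∀ w, (Fintype.card K : ℚ) ^ 2 *
        (#{f ∈ S | e x f = v ∧ e z f = w} * sliceExcess S (e z) w) =
        sliceExcess S (e z) w ^ 2 + (sliceExcess S (e x) v + #S) * sliceExcess S (e z) w := by
      intro w
      linear_combination sliceExcess S (e z) w * hslice x z hz.symm v w
    rw [Finset.sum_congr rfl fun w _ => hin w, Finset.mul_sum,
      Finset.sum_congr rfl fun w _ => hin' w, Finset.sum_add_distrib, ← Finset.mul_sum,
      sum_sliceExcess, mul_zero, add_zero]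
  have h3 : ∑ f ∈ T, sliceExcess S (e x) (e x f) = #T * sliceExcess S (e x) v := by
    rw [← nsmul_eq_mul, ← Finset.sum_const]
    refine Finset.sum_congr rfl fun f hf => ?_
    rw [(mem_filter.mp hf).2]
  rw [Finset.sum_comm, ← Finset.add_sum_erase _ _ (mem_univ x), h3] at h1
  rw [← Finset.sum_congr rfl fun z hz => h2 z (Finset.ne_of_mem_erase hz), ← Finset.mul_sum]
  rw [hTcard] at h1
  have hx : sliceExcess S (e x) v = Fintype.card K * sliceCard S (e x) v - #S := rfl
  rw [hx] at h1
  linear_combination -(Fintype.card K : ℚ) ^ 2 * h1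

variable [Fintype V]

theorem card_eval_pair_mul {e : K → Dual K V}
    (hpair : ∀ x y, x ≠ y → ∀ v w, ∃ f, e x f = v ∧ e y f = w)
    {x z : K} (hxz : x ≠ z) (v w : K) :
    #{f : V | e x f = v ∧ e z f = w} * Fintype.card K ^ 2 = Fintype.card V := by
  have hsurj : Function.Surjective ((e x).prod (e z)) := by
    rintro ⟨a, b⟩
    obtain ⟨f, rfl, rfl⟩ := hpair x z hxz a b
    exact ⟨f, rfl⟩
  have := card_fiber_mul_card _ hsurj (v, w)
  simpa [Prod.ext_iff, sq] using this

theorem card_eval_triple_mul {e : K → Dual K V}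
    (htriple : ∀ x y z, x ≠ y → x ≠ z → y ≠ z → ∀ u v w, ∃ f, e x f = u ∧ e y f = v ∧ e z f = w)
    {x y z : K} (hxy : x ≠ y) (hxz : x ≠ z) (hyz : y ≠ z) (u v w : K) :
    #{f : V | (e x f = u ∧ e y f = v) ∧ e z f = w} * Fintype.card K ^ 3 = Fintype.card V := by
  have hsurj : Function.Surjective ((e x).prod ((e y).prod (e z))) := by
    rintro ⟨a, b, c⟩
    obtain ⟨f, rfl, rfl, rfl⟩ := htriple x y z hxy hxz hyz a b c
    exact ⟨f, rfl⟩
  have := card_fiber_mul_card _ hsurj (u, v, w)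
  simpa [Prod.ext_iff, pow_succ, mul_assoc, and_assoc] using this

theorem sum_eval_pair_eq_zero {e : K → Dual K V}
    (htriple : ∀ x y z, x ≠ y → x ≠ z → y ≠ z → ∀ u v w, ∃ f, e x f = u ∧ e y f = v ∧ e z f = w)
    {x y z : K} (hxy : x ≠ y) (hxz : x ≠ z) (hyz : y ≠ z) (u v : K) (G : K → ℚ)
    (hG : ∑ w, G w = 0) :
    ∑ f : V with e x f = u ∧ e y f = v, G (e z f) = 0 := by
  rw [← Finset.sum_fiberwise_of_maps_to (g := e z) (t := univ) (fun _ _ => mem_univ _)]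
  have hconst : ∀ w, #{f : V | (e x f = u ∧ e y f = v) ∧ e z f = w} =
      #{f : V | (e x f = u ∧ e y f = v) ∧ e z f = 0} := fun w =>
    Nat.eq_of_mul_eq_mul_right (pow_pos (Fintype.card_pos (α := K)) 3)
      ((card_eval_triple_mul htriple hxy hxz hyz u v w).trans
        (card_eval_triple_mul htriple hxy hxz hyz u v 0).symm)
  have hin : ∀ w, ∑ f ∈ ({f : V | e x f = u ∧ e y f = v} : Finset V) with e z f = w, G (e z f) =
      #{f : V | (e x f = u ∧ e y f = v) ∧ e z f = 0} * G w := by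
    intro w
    rw [Finset.filter_filter, ← hconst w, ← nsmul_eq_mul, ← Finset.sum_const]
    refine Finset.sum_congr rfl fun f hf => ?_
    rw [(mem_filter.mp hf).2.2]
  rw [Finset.sum_congr rfl fun w _ => hin w, ← Finset.mul_sum, hG, mul_zero]

/-- Sum `hsum` over the fibre in V. At any third point the values are equidistributed on that fibre,
so its excesses cancel and only those at `x` and `z` remain. -/
theorem card_sq_mul_card_pair_slice [DecidableEq V] {e : K → Dual K V} {S : Finset V}
    (hne : S.Nonempty) (hcard : #S * Fintype.card K = Fintype.card V)
    (hpair : ∀ x y, x ≠ y → ∀ v w, ∃ f, e x f = v ∧ e y f = w)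
    (htriple : ∀ x y z, x ≠ y → x ≠ z → y ≠ z → ∀ u v w, ∃ f, e x f = u ∧ e y f = v ∧ e z f = w)
    (hsum : ∀ f, ∑ x, sliceExcess S (e x) (e x f) =
      #S * Fintype.card K * (if f ∈ S then 1 else 0) - #S)
    {x z : K} (hxz : x ≠ z) (v w : K) :
    (Fintype.card K : ℚ) ^ 2 * #{f ∈ S | e x f = v ∧ e z f = w} =
      sliceExcess S (e x) v + sliceExcess S (e z) w + #S := by
  set D : Finset V := {f : V | e x f = v ∧ e z f = w} with hD
  have hDcard : (#D : ℚ) * Fintype.card K ^ 2 = #S * Fintype.card K := by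
    exact_mod_cast (card_eval_pair_mul hpair hxz v w).trans hcard.symm
  have h1 : ∑ f ∈ D, ∑ y, sliceExcess S (e y) (e y f) =
      #S * Fintype.card K * #{f ∈ S | e x f = v ∧ e z f = w} - #D * #S := by
    rw [Finset.sum_congr rfl fun f _ => hsum f, Finset.sum_sub_distrib, ← Finset.mul_sum,
      Finset.sum_boole, Finset.sum_const, nsmul_eq_mul]
    congr 4
    ext f
    simp [hD, and_comm]
  have h2 : ∑ f ∈ D, ∑ y, sliceExcess S (e y) (e y f) =
      #D * sliceExcess S (e x) v + #D * sliceExcess S (e z) w := by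
    rw [Finset.sum_comm, ← Finset.sum_subset (Finset.subset_univ {x, z}), Finset.sum_pair hxz]
    · congr 1
      · rw [← nsmul_eq_mul, ← Finset.sum_const]
        refine Finset.sum_congr rfl fun f hf => ?_
        rw [(mem_filter.mp hf).2.1]
      · rw [← nsmul_eq_mul, ← Finset.sum_const]
        refine Finset.sum_congr rfl fun f hf => ?_
        rw [(mem_filter.mp hf).2.2]
    · intro y _ hy
      simp only [mem_insert, mem_singleton, not_or] at hy
      exact sum_eval_pair_eq_zero htriple hxz (Ne.symm hy.1) (Ne.symm hy.2) v w _
        (sum_sliceExcess S (e y))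
  have hq : (Fintype.card K : ℚ) ≠ 0 := by exact_mod_cast Fintype.card_ne_zero
  have hs : (#S : ℚ) ≠ 0 := by exact_mod_cast hne.card_pos.ne'
  apply mul_left_cancel₀ (mul_ne_zero hs hq)
  linear_combination (Fintype.card K : ℚ) ^ 2 * (h2 - h1) +
    (sliceExcess S (e x) v + sliceExcess S (e z) w + #S) * hDcard

/-- In a vector space with a family of `|K|` sufficiently independent functionals, a largest
subset any two of whose members agree under one of the functionals is a fibre of one of them. -/
theorem exists_forall_eval_eq {e : K → Dual K V} {S : Finset V}
    (hq : 3 ≤ Fintype.card K) (hcard : #S * Fintype.card K = Fintype.card V)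
    (hS : ∀ f ∈ S, ∀ g ∈ S, ∃ x, e x f = e x g)
    (htriple : ∀ x y z, x ≠ y → x ≠ z → y ≠ z → ∀ u v w, ∃ f, e x f = u ∧ e y f = v ∧ e z f = w)
    (hdual : ∀ ℓ : Dual K V, (∀ h, (∀ x, e x h ≠ 0) → ℓ h ≠ 0) →
      ∃ (x : K) (a : K), ℓ = a • e x) :
    ∃ x y, ∀ f ∈ S, e x f = y := by
  classical
  have : Finite (Dual K V) := DFunLike.finite _
  have := Fintype.ofFinite (Dual K V)
  have hpair : ∀ x y, x ≠ y → ∀ v w, ∃ f, e x f = v ∧ e y f = w := by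
    intro x y hxy v w
    obtain ⟨z, hz⟩ : ∃ z, z ∉ ({x, y} : Finset K) := by
      by_contra! hall
      have h1 := Finset.card_le_card (fun z _ => hall z : (univ : Finset K) ⊆ {x, y})
      rw [Finset.card_univ] at h1
      have := Finset.card_le_two (a := x) (b := y)
      omega
    simp only [mem_insert, mem_singleton, not_or] at hz
    obtain ⟨f, h1, h2, -⟩ := htriple x y z hxy (Ne.symm hz.1) (Ne.symm hz.2) v w 0
    exact ⟨f, h1, h2⟩
  have hpos : 0 < #S := by
    have : 0 < #S * Fintype.card K := hcard ▸ Fintype.card_pos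
    exact Nat.pos_of_mul_pos_right this
  have hne : S.Nonempty := Finset.card_pos.mp hpos
  have hsum := sum_sliceExcess_eval hcard hS hpair hdual
  have hslice : ∀ x z, x ≠ z → ∀ v w,
      (Fintype.card K : ℚ) ^ 2 * #{f ∈ S | e x f = v ∧ e z f = w} =
        sliceExcess S (e x) v + sliceExcess S (e z) w + #S := fun x z hxz v w =>
    card_sq_mul_card_pair_slice hne hcard hpair htriple hsum hxz v w
  have hconst := card_cube_mul_sliceCard_mul hsum hslice
  have hq0 : (Fintype.card K : ℚ) ^ 3 ≠ 0 :=
    pow_ne_zero _ (by exact_mod_cast Fintype.card_ne_zero)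
  have hdich := fun x => exists_eq_of_mul_sub_const hq (#S : ℚ) (sliceCard S (e x))
    (fun v => Nat.cast_nonneg _) (sum_sliceCard S (e x))
    (fun v w => mul_left_cancel₀ hq0 ((hconst x v).trans (hconst x w).symm))
  by_cases hflat : ∀ x v, Fintype.card K * sliceCard S (e x) v = #S
  -- All excesses vanish here, so `hsum` at a member of S reads 0 = s(q - 1).
  · obtain ⟨f, hf⟩ := hne
    have h1 := hsum f
    rw [if_pos hf, Finset.sum_eq_zero fun x _ => by rw [sliceExcess, hflat, sub_self]] at h1
    have h2 : (0 : ℚ) < #S := by exact_mod_cast hpos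
    have h3 : (3 : ℚ) ≤ Fintype.card K := by exact_mod_cast hq
    nlinarith
  · push Not at hflat
    obtain ⟨x, v, hxv⟩ := hflat
    obtain ⟨y, hy⟩ := (hdich x).resolve_left fun h => hxv (h v)
    refine ⟨x, y, fun f hf => ?_⟩
    rw [sliceCard] at hy
    have h1 : #{g ∈ S | e x g = y} = #S := by exact_mod_cast hy
    exact Finset.card_filter_eq_iff.mp h1 f hf

end PointPairs

/-! ### Polynomials of bounded degree -/

section PolynomialSpace

open Finset Module Polynomial

variable {F : Type*} [Field F]

theorem mem_degreeLT_succ_iff {k : ℕ} {f : F[X]} :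
    f ∈ degreeLT F (k + 1) ↔ f.degree ≤ (k : WithBot ℕ) := by
  rw [mem_degreeLT]
  cases f.degree with
  | bot => simp
  | coe n => exact WithBot.coe_lt_coe.trans (Nat.lt_add_one_iff.trans WithBot.coe_le_coe.symm)

instance finite_degreeLT [Finite F] (n : ℕ) : Finite (degreeLT F n) :=
  Finite.of_equiv _ (degreeLTEquiv F n).symm.toEquiv

theorem card_degreeLT [Fintype F] (n : ℕ) : Nat.card (degreeLT F n) = Fintype.card F ^ n := by
  rw [Nat.card_congr (degreeLTEquiv F n).toEquiv, Nat.card_fun, Nat.card_fin, Nat.card_eq_fintype_card]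

/-- Evaluation at a point, as a functional on the polynomials of degree less than `n`. -/
noncomputable def evalDegreeLT (n : ℕ) (x : F) : Dual F (degreeLT F n) :=
  (Polynomial.leval x).comp (degreeLT F n).subtype

@[simp]
theorem evalDegreeLT_apply (n : ℕ) (x : F) (f : degreeLT F n) :
    evalDegreeLT n x f = (f : F[X]).eval x := rfl

theorem exists_evalDegreeLT_triple {n : ℕ} (hn : 3 ≤ n) {x y z : F} (hxy : x ≠ y) (hxz : x ≠ z)
    (hyz : y ≠ z) (u v w : F) :
    ∃ f, evalDegreeLT n x f = u ∧ evalDegreeLT n y f = v ∧ evalDegreeLT n z f = w := by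
  classical
  let r : F → F := fun a => if a = x then u else if a = y then v else w
  have hinj : Set.InjOn (id : F → F) (({x, y, z} : Finset F) : Set F) := Function.injective_id.injOn
  have hdeg := Lagrange.degree_interpolate_lt r hinj
  refine ⟨⟨Lagrange.interpolate {x, y, z} id r, ?_⟩, ?_, ?_, ?_⟩
  · rw [mem_degreeLT]
    refine hdeg.trans_le ?_
    exact_mod_cast Finset.card_le_three.trans hn
  · simpa [r] using Lagrange.eval_interpolate_at_node r hinj (i := x) (by simp)
  · simpa [r, hxy.symm] using Lagrange.eval_interpolate_at_node r hinj (i := y) (by simp)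
  · simpa [r, hxz.symm, hyz.symm] using
      Lagrange.eval_interpolate_at_node r hinj (i := z) (by simp)

/-- A functional on polynomials of bounded degree that vanishes at no polynomial without roots
is a multiple of an evaluation. -/
theorem exists_eq_smul_evalDegreeLT [Finite F] {n : ℕ} (hn : 2 ≤ n) (ℓ : Dual F (degreeLT F n))
    (hℓ : ∀ h, (∀ x, evalDegreeLT n x h ≠ 0) → ℓ h ≠ 0) :
    ∃ (x : F) (a : F), ℓ = a • evalDegreeLT n x := by
  let one : degreeLT F n := ⟨1, mem_degreeLT.mpr (by
    rw [degree_one]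
    exact_mod_cast (by omega : 0 < n))⟩
  let X' : degreeLT F n := ⟨X, mem_degreeLT.mpr (by
    rw [degree_X]
    exact_mod_cast (by omega : 1 < n))⟩
  have hone : ∀ x, evalDegreeLT n x one = 1 := fun x => by simp [one]
  have hX : ∀ x, evalDegreeLT n x X' = x := fun x => by simp [X']
  have ha : ℓ one ≠ 0 := hℓ one fun x => by simp [hone]
  set a := ℓ one
  set β := ℓ X' / a with hβ
  refine ⟨β, a, LinearMap.ext fun h => ?_⟩
  -- The constants place h - ℓ(h)/a + b(X - β) in the kernel of `ℓ`, so it must have a root.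
  have hroot : ∀ b : F, ∃ x, evalDegreeLT n x h - ℓ h / a + b * (x - β) = 0 := by
    intro b
    by_contra! hno
    apply hℓ (h - (ℓ h / a) • one + b • (X' - β • one))
    · intro x
      simp only [map_add, map_sub, map_smul, smul_eq_mul, hone, hX, mul_one]
      exact hno x
    · simp only [map_add, map_sub, map_smul, smul_eq_mul]
      change ℓ h - ℓ h / a * a + b * (ℓ X' - β * a) = 0
      rw [hβ]
      field_simp
      ring
  choose r hr using hroot
  -- A point other than `β` is a root for at most one `b`. If `β` were never chosen, `r` would be
  -- injective, hence onto the finite field, and would hit `β` after all. At the root `β` the term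
  -- in `b` drops out, leaving h(β) = ℓ(h)/a.
  have hmem : ∃ b, r b = β := by
    by_contra! hno
    have hinj : Function.Injective r := by
      intro b c hbc
      have h1 : (b - c) * (r c - β) = 0 := by
        have := hr b
        rw [hbc] at this
        linear_combination this - hr c
      rcases mul_eq_zero.mp h1 with h2 | h2
      · exact sub_eq_zero.mp h2
      · exact absurd (sub_eq_zero.mp h2) (hno c)
    obtain ⟨b, hb⟩ := Finite.surjective_of_injective hinj β
    exact hno b hb
  obtain ⟨b, hb⟩ := hmem
  have h1 := hr b
  rw [hb, sub_self, mul_zero, add_zero, sub_eq_zero] at h1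
  rw [LinearMap.smul_apply, h1, smul_eq_mul]
  field_simp

theorem card_mul_card_degreeLT_le [Fintype F] {t n : ℕ} (htn : t ≤ n)
    {𝓕 : Set F[X]} (hdeg : 𝓕 ⊆ degreeLT F n) (hint : IsTIntersectingFamily t 𝓕) :
    𝓕.ncard * Fintype.card F ^ t ≤ Fintype.card F ^ n := by
  classical
  rw [← card_degreeLT, ← card_degreeLT, ← Nat.card_coe_set_eq, ← Nat.card_prod]
  have hsub : ∀ g : degreeLT F t, (g : F[X]) ∈ degreeLT F n := fun g =>
    degreeLT_mono htn g.2
  refine Nat.card_le_card_of_injective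
    (fun p : 𝓕 × degreeLT F t => (⟨p.1 + p.2, add_mem (hdeg p.1.2) (hsub p.2)⟩ : degreeLT F n)) ?_
  rintro ⟨⟨f, hf⟩, ⟨g, hg⟩⟩ ⟨⟨f', hf'⟩, ⟨g', hg'⟩⟩ h
  have h0 : f + g = f' + g' := congrArg Subtype.val h
  have hff : f = f' := by
    by_contra hne
    have h1 : t ≤ {x : F | f.eval x = f'.eval x}.ncard := hint f hf f' hf' hne
    rw [Set.ncard_eq_toFinset_card'] at h1
    refine hne (eq_of_degree_sub_lt_of_eval_finset_eq
      {x : F | f.eval x = f'.eval x}.toFinset ?_ (fun x hx => by simpa using hx))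
    have h2 : f - f' = g' - g := by linear_combination h0
    rw [h2]
    exact (mem_degreeLT.mp (sub_mem hg' hg)).trans_le (by exact_mod_cast h1)
  subst hff
  have hgg : g = g' := add_left_cancel h0
  subst hgg
  rfl

theorem ncard_setOf_degree_le_eval_eq [Fintype F] (k : ℕ) (x y : F) :
    {f : F[X] | f.degree ≤ (k : WithBot ℕ) ∧ f.eval x = y}.ncard = Fintype.card F ^ k := by
  classical
  have := Fintype.ofFinite (degreeLT F (k + 1))
  have hsurj : Function.Surjective (evalDegreeLT (k + 1) x) := fun c =>
    ⟨⟨C c, mem_degreeLT.mpr (degree_C_le.trans_lt (by exact_mod_cast k.succ_pos))⟩, by simp⟩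
  have h := card_fiber_mul_card _ hsurj y
  rw [← Nat.card_eq_fintype_card (α := degreeLT F (k + 1)), card_degreeLT, pow_succ] at h
  rw [← Nat.eq_of_mul_eq_mul_right Fintype.card_pos h,
    ← Set.ncard_coe_finset, ← Set.ncard_image_of_injective _ Subtype.val_injective]
  congr 1
  ext f
  constructor
  · rintro ⟨hf, hfx⟩
    exact ⟨⟨f, mem_degreeLT_succ_iff.mpr hf⟩, Finset.mem_coe.mpr (Finset.mem_filter.mpr ⟨mem_univ _, hfx⟩), rfl⟩
  · rintro ⟨g, hg, rfl⟩
    exact ⟨mem_degreeLT_succ_iff.mp g.2, (Finset.mem_filter.mp (Finset.mem_coe.mp hg)).2⟩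

end PolynomialSpace

/-! ### The extremal families and the theorem -/

open Polynomial in
theorem exists_forall_eval_eq_of_ncard_eq {F : Type*} [Field F] [Fintype F] {k : ℕ} (hk : 2 ≤ k)
    (hkq : k < Fintype.card F) {𝓕 : Set F[X]} (hdeg : 𝓕 ⊆ degreeLT F (k + 1))
    (hint : IsTIntersectingFamily 1 𝓕) (hcard : 𝓕.ncard = Fintype.card F ^ k) :
    ∃ x y : F, ∀ f ∈ 𝓕, f.eval x = y := by
  classical
  have := Fintype.ofFinite (degreeLT F (k + 1))
  let S : Finset (degreeLT F (k + 1)) := {f | (f : F[X]) ∈ 𝓕}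
  have hS : S.card = Fintype.card F ^ k := by
    rw [← hcard, ← Set.ncard_coe_finset, ← Set.ncard_image_of_injective _ Subtype.val_injective]
    congr 1
    ext f
    simpa [S] using fun hf => hdeg hf
  obtain ⟨x, y, hxy⟩ := exists_forall_eval_eq (e := evalDegreeLT (k + 1)) (S := S) (by omega)
    (by rw [hS, ← pow_succ, ← card_degreeLT, Nat.card_eq_fintype_card])
    (by
      intro f hf g hg
      by_cases hfg : f = g
      · exact ⟨0, by rw [hfg]⟩
      · have h1 : 1 ≤ {x : F | (f : F[X]).eval x = (g : F[X]).eval x}.ncard :=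
          hint f (by simpa [S] using hf) g (by simpa [S] using hg)
            (fun h => hfg (Subtype.ext h))
        exact Set.nonempty_of_ncard_ne_zero (Nat.one_le_iff_ne_zero.mp h1))
    (fun x y z hxy hxz hyz u v w => exists_evalDegreeLT_triple (by omega) hxy hxz hyz u v w)
    (exists_eq_smul_evalDegreeLT (by omega))
  exact ⟨x, y, fun f hf => hxy ⟨f, hdeg hf⟩ (by simpa [S] using hf)⟩

theorem theorem1p2 {F : Type*} [Field F] [Fintype F] (t k : ℕ)
    (htk : t ≤ k) (hkq : k < Fintype.card F)
    (𝓕 : Set (Polynomial F))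
    (hdeg : ∀ f ∈ 𝓕, f.degree ≤ (k : WithBot ℕ))
    (hint : IsTIntersectingFamily t 𝓕) :
    𝓕.Finite ∧ 𝓕.ncard ≤ Fintype.card F ^ (k + 1 - t) ∧
      (t = 1 → 2 ≤ k →
        (𝓕.ncard = Fintype.card F ^ (k + 1 - t) ↔
          ∃ x y : F, 𝓕 = {f : Polynomial F | f.degree ≤ (k : WithBot ℕ) ∧ f.eval x = y})) := by
  have hdeg' : 𝓕 ⊆ Polynomial.degreeLT F (k + 1) := fun f hf =>
    mem_degreeLT_succ_iff.mpr (hdeg f hf)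
  have hfin : (Polynomial.degreeLT F (k + 1) : Set (Polynomial F)).Finite :=
    Set.finite_coe_iff.mp (finite_degreeLT (k + 1))
  refine ⟨hfin.subset hdeg', ?_, ?_⟩
  · have h1 := card_mul_card_degreeLT_le (by omega : t ≤ k + 1) hdeg' hint
    rw [← Nat.sub_add_cancel (by omega : t ≤ k + 1), pow_add] at h1
    exact Nat.le_of_mul_le_mul_right h1 (pow_pos Fintype.card_pos t)
  · rintro rfl hk
    rw [Nat.add_sub_cancel]
    constructor
    · intro hcard
      obtain ⟨x, y, hxy⟩ := exists_forall_eval_eq_of_ncard_eq hk hkq hdeg' hint hcard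
      refine ⟨x, y, Set.eq_of_subset_of_ncard_le (fun f hf => ⟨hdeg f hf, hxy f hf⟩) ?_ ?_⟩
      · rw [ncard_setOf_degree_le_eval_eq, hcard]
      · refine hfin.subset fun f hf => mem_degreeLT_succ_iff.mpr hf.1
    · rintro ⟨x, y, rfl⟩
      exact ncard_setOf_degree_le_eval_eq k x y
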